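/- An ordered semigroup is a semigroup $S$ with a partial order $\le$ that is stable: $s\le t$ implies $as\le at$ and $sa\le ta$ for all $a,s,t\in S$. A pseudovariety of ordered semigroups is a class of finite ordered semigroups closed under homomorphic images (images under surjective order-preserving semigroup homomorphisms), ordered subsemigroups and finite direct products. A semigroup is completely regular if each of its elements lies in a subgroup of it, and it is a semilattice if it is commutative and all its elements are idempotent. Theorem. Let $\mathbf V$ be a pseudovariety of ordered semigroups all of whose members are completely regular, and suppose that $\mathbf V$ contains all finite semilattices (with every stable partial order). Then $\mathbf V$ is selfdual: a finite ordered semigroup $(S,\cdot,\le)$ belongs to $\mathbf V$ if and only if $(S,\cdot,\ge)$ does. -/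

import Mathlib

universe u

/-- A finite (nonempty) ordered semigroup: a finite semigroup equipped with a partial order that is
stable, i.e. `s ≤ t` implies `a * s ≤ a * t` and `s * a ≤ t * a`. -/
structure FinOrdSemigroup : Type (u + 1) where
  /-- The underlying set. -/
  carrier : Type u
  [semigroup : Semigroup carrier]
  [partialOrder : PartialOrder carrier]
  [mulLeftMono : MulLeftMono carrier]
  [mulRightMono : MulRightMono carrier]
  [finite : Finite carrier]
  [nonempty : Nonempty carrier]

namespace FinOrdSemigroup

instance : CoeSort FinOrdSemigroup.{u} (Type u) := ⟨carrier⟩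

attribute [instance] semigroup partialOrder mulLeftMono mulRightMono finite nonempty

/-- The same semigroup with the reversed order. -/
def dual (S : FinOrdSemigroup.{u}) : FinOrdSemigroup.{u} where
  carrier := (S : Type u)ᵒᵈ
  finite := S.finite
  nonempty := S.nonempty

/-- A nonempty subsemigroup, with the induced order. -/
def ofSubsemigroup (S : FinOrdSemigroup.{u}) (T : Subsemigroup S) (hT : (T : Set S).Nonempty) :
    FinOrdSemigroup.{u} where
  carrier := T
  mulLeftMono := ⟨fun a _ _ h => mul_le_mul_right (α := S) h a⟩
  mulRightMono := ⟨fun a _ _ h => mul_le_mul_left (α := S) h a⟩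
  finite := Subtype.finite
  nonempty := hT.to_subtype

/-- The direct product of finitely many finite ordered semigroups, with componentwise
multiplication and order; for `n = 0` it is the one-element semigroup. -/
def pi {n : ℕ} (S : Fin n → FinOrdSemigroup.{u}) : FinOrdSemigroup.{u} where
  carrier := ∀ i, S i
  mulLeftMono := ⟨fun a b c (h : b ≤ c) i => mul_le_mul_right (h i) (a i)⟩
  mulRightMono := ⟨fun a b c (h : b ≤ c) i => mul_le_mul_left (h i) (a i)⟩

end FinOrdSemigroup

/-- A subsemigroup that is a group under the induced multiplication. -/
def Subsemigroup.IsSubgroup {S : Type*} [Semigroup S] (G : Subsemigroup S) : Prop :=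
  ∃ e ∈ G, (∀ a ∈ G, e * a = a ∧ a * e = a) ∧ ∀ a ∈ G, ∃ b ∈ G, b * a = e ∧ a * b = e

/-- A semigroup is completely regular if each of its elements lies in a subgroup. -/
def IsCompletelyRegular (S : Type*) [Semigroup S] : Prop :=
  ∀ s : S, ∃ G : Subsemigroup S, G.IsSubgroup ∧ s ∈ G

/-- A semigroup is a semilattice if its multiplication is idempotent and commutative. -/
def IsSemilattice (S : Type*) [Semigroup S] : Prop :=
  (∀ s : S, s * s = s) ∧ ∀ s t : S, s * t = t * s

/-- A pseudovariety of ordered semigroups: a class of finite ordered semigroups closed under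
homomorphic images (by isotone homomorphisms), ordered subsemigroups and finite products. -/
structure IsPseudovariety (V : Set FinOrdSemigroup.{u}) : Prop where
  image_mem : ∀ S ∈ V, ∀ (T : FinOrdSemigroup.{u}) (f : S →ₙ* T),
    Monotone f → Function.Surjective f → T ∈ V
  subsemigroup_mem : ∀ S ∈ V, ∀ (T : Subsemigroup S) (hT : (T : Set S).Nonempty),
    S.ofSubsemigroup T hT ∈ V
  pi_mem : ∀ (n : ℕ) (S : Fin n → FinOrdSemigroup.{u}), (∀ i, S i ∈ V) →
    FinOrdSemigroup.pi S ∈ V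

/-- The class of all dually ordered members of `V`. -/
def dualClass (V : Set FinOrdSemigroup.{u}) : Set FinOrdSemigroup.{u} :=
  {S | S.dual ∈ V}

/-- A class of finite ordered semigroups is selfdual if it equals its dual class. -/
def IsSelfdual (V : Set FinOrdSemigroup.{u}) : Prop :=
  V = dualClass V

/-! Given $S\in\mathbf V$, let $F$ be the ordered semigroup generated by the letters $x\in S$ in the
product of $S^{S^S}$ and the semilattice of subsets of $S$ ordered by equality. An inequality in $F$
is an inequality $u\le v$ valid in $S$ between words with the same letters. If every such inequality
is reversible, evaluating letters at themselves is an order-reversing surjection $F\to S$, so the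
dual of $S$ is an image of $F$ and lies in $\mathbf V$.

Reversibility is `IsCRPreorder.symm_of_mem_iff`, proved by induction on the number of letters.
Comparable elements of one $\mathcal H$-class coincide, because a stable order on a group of finite
exponent is trivial (`eq_of_le_of_green`). So it suffices that $u$ and $v$ become $\mathcal
H$-related in the quotient, and by reversing words only $\mathcal R$ is needed.

The key is $v\le uw$ for some word $w$ over the letters of $u$ (`exists_le_mul`). Look at the letter
whose first occurrence comes last. If it is the same in $u$ and $v$, the prefixes before it have
fewer letters and are comparable in the auxiliary preorder `rightFactor`, so induction applies.
Otherwise two letters first occur in opposite orders, and substituting $v$ and $u$ for them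
exchanges the sides. -/

/-! ### Words, their letters and substitutions -/

namespace FreeMonoid

variable {X : Type*}

theorem exists_eq_mul_of_mul {a : X} {p : FreeMonoid X} (h : a ∈ p) :
    ∃ s t, p = s * of a * t ∧ a ∉ s := by
  obtain ⟨s, t, hp, hs⟩ := List.eq_append_cons_of_mem h
  exact ⟨ofList s, ofList t, by rw [mul_assoc]; exact hp, hs⟩

/-- Every nonempty word splits at the first occurrence of the letter that occurs first the
latest. -/
theorem exists_last_new_letter {p : FreeMonoid X} (h : p ≠ 1) :
    ∃ s a t, p = s * of a * t ∧ a ∉ s ∧ ∀ x ∈ t, x ∈ s * of a := by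
  suffices H : ∀ l : List X, l ≠ [] → ∃ s a t, ofList l = s * of a * t ∧ a ∉ s ∧
      ∀ x ∈ t, x ∈ s * of a from H p.toList h
  intro l
  induction l using List.reverseRecOn with
  | nil => exact fun h => absurd rfl h
  | append_singleton l b ih =>
    intro _
    by_cases hb : b ∈ l
    · obtain ⟨s, a, t, hl, has, ht⟩ := ih (List.ne_nil_of_mem hb)
      refine ⟨s, a, t * of b, ?_, has, ?_⟩
      · rw [ofList_append, hl, ofList_singleton]; simp only [mul_assoc]
      · intro x hx
        rcases mem_mul.1 hx with hx | hx
        · exact ht x hx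
        · have : b ∈ s * of a * t := hl ▸ hb
          obtain rfl := mem_of.1 hx
          rcases mem_mul.1 this with h | h
          · exact h
          · exact ht _ h
    · refine ⟨ofList l, b, 1, ?_, hb, fun x hx => absurd hx notMem_one⟩
      rw [ofList_append, mul_one, ofList_singleton]

theorem exists_eq_of_mul {p : FreeMonoid X} (h : p ≠ 1) : ∃ x q, p = of x * q := by
  cases p with
  | one => exact absurd rfl h
  | of_mul x q => exact ⟨x, q, rfl⟩

theorem lift_congr {M : Type*} [Monoid M] {σ τ : X → M} {p : FreeMonoid X}
    (h : ∀ x ∈ p, σ x = τ x) : lift σ p = lift τ p := by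
  rw [lift_apply, lift_apply, List.map_congr_left (l := toList p) h]

theorem exists_mem_of_mem_lift {σ : X → FreeMonoid X} {p : FreeMonoid X} {y : X}
    (h : y ∈ lift σ p) : ∃ x ∈ p, y ∈ σ x := by
  induction p with
  | one => exact absurd h notMem_one
  | of x => exact ⟨x, mem_of_self, h⟩
  | mul p q hp hq =>
    rw [map_mul] at h
    rcases mem_mul.1 h with h | h
    · obtain ⟨x, hx, hy⟩ := hp h
      exact ⟨x, mem_mul.2 (.inl hx), hy⟩
    · obtain ⟨x, hx, hy⟩ := hq h
      exact ⟨x, mem_mul.2 (.inr hx), hy⟩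

theorem lift_ne_one {σ : X → FreeMonoid X} (hσ : ∀ x, σ x ≠ 1) {p : FreeMonoid X} (hp : p ≠ 1) :
    lift σ p ≠ 1 := by
  obtain ⟨x, q, rfl⟩ := exists_eq_of_mul hp
  intro h
  rw [map_mul, ← length_eq_zero, length_mul] at h
  exact hσ x (length_eq_zero.1 (by rw [lift_eval_of] at h; omega))

theorem mem_of_mem_pow {p : FreeMonoid X} {y : X} : ∀ {n : ℕ}, y ∈ p ^ n → y ∈ p
  | 0, h => absurd h notMem_one
  | n + 1, h => by
    rw [pow_succ] at h
    exact (mem_mul.1 h).elim mem_of_mem_pow id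

theorem mul_ne_one_left {p : FreeMonoid X} (hp : p ≠ 1) (q : FreeMonoid X) : q * p ≠ 1 := by
  intro h
  rw [← length_eq_zero, length_mul] at h
  exact hp (length_eq_zero.1 (by omega))

theorem mem_reverse {p : FreeMonoid X} {x : X} : x ∈ reverse p ↔ x ∈ p := List.mem_reverse

theorem reverse_pow (p : FreeMonoid X) (n : ℕ) : reverse (p ^ n) = reverse p ^ n := by
  induction n with
  | zero => rfl
  | succ n ih => rw [pow_succ, reverse_mul, ih, pow_succ']

theorem reverse_lift (σ : X → FreeMonoid X) (p : FreeMonoid X) :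
    reverse (lift σ p) = lift (fun x => reverse (σ x)) (reverse p) := by
  induction p with
  | one => rfl
  | of x => rfl
  | mul p q hp hq => rw [map_mul, reverse_mul, hp, hq, reverse_mul, map_mul]

end FreeMonoid

/-! ### Monoids satisfying `x ^ (n + 2) = x` -/

section PowEqSelf

open FreeMonoid

variable {X M : Type*} [Monoid M] {n : ℕ}

/-- Appending letters that already occur does not leave the $\mathcal R$-class: each can be undone
by a further factor on the right. -/
theorem exists_map_mul_mul_eq_map (hM : ∀ x : M, x ^ (n + 2) = x) (f : FreeMonoid X →* M)
    (q : FreeMonoid X) : ∀ p : FreeMonoid X, (∀ x ∈ q, x ∈ p) →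
      ∃ k, (∀ x ∈ k, x ∈ p) ∧ f (p * q * k) = f p := by
  induction q with
  | one => exact fun p _ => ⟨1, fun x hx => absurd hx notMem_one, by simp⟩
  | of a =>
    intro p h
    obtain ⟨s, t, rfl, -⟩ := exists_eq_mul_of_mul (h a mem_of_self)
    -- This factor completes $s(at)a$ to $s(at)^{n+2}$, which has the same image as $sat$.
    refine ⟨t * (of a * t) ^ n, ?_, ?_⟩
    · intro x hx
      rcases mem_mul.1 hx with hx | hx
      · simp [hx]
      · have := mem_of_mem_pow hx
        simp only [mem_mul] at this ⊢
        tauto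
    · have := hM (f (of a * t))
      calc f (s * of a * t * of a * (t * (of a * t) ^ n))
          = f s * (f (of a * t) ^ (n + 2)) := by
            simp only [map_mul, map_pow, pow_succ', mul_assoc]
        _ = _ := by rw [this]; simp only [map_mul, mul_assoc]
  | mul q₁ q₂ h₁ h₂ =>
    intro p h
    obtain ⟨k₁, hk₁, e₁⟩ := h₁ p fun x hx => h x (mem_mul.2 (.inl hx))
    obtain ⟨k₂, hk₂, e₂⟩ := h₂ (p * q₁) fun x hx => mem_mul.2 (.inl (h x (mem_mul.2 (.inr hx))))
    refine ⟨k₂ * k₁, ?_, ?_⟩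
    · intro x hx
      rcases mem_mul.1 hx with hx | hx
      · exact (mem_mul.1 (hk₂ x hx)).elim id fun hx => h x (mem_mul.2 (.inl hx))
      · exact hk₁ x hx
    · rw [← e₁, map_mul f (p * q₁) k₁, ← e₂]
      simp only [map_mul, mul_assoc]

theorem exists_map_mul_mul_eq_map' (hM : ∀ x : M, x ^ (n + 2) = x) (f : FreeMonoid X →* M)
    (p q : FreeMonoid X) (h : ∀ x ∈ q, x ∈ p) : ∃ k, f (k * q * p) = f p := by
  induction q generalizing p with
  | one => exact ⟨1, by simp⟩
  | of a =>
    obtain ⟨s, t, rfl, -⟩ := exists_eq_mul_of_mul (h a mem_of_self)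
    refine ⟨(s * of a) ^ n * s, ?_⟩
    have := hM (f (s * of a))
    calc f ((s * of a) ^ n * s * of a * (s * of a * t))
        = f (s * of a) ^ (n + 2) * f t := by
          simp only [map_mul, map_pow, pow_succ, mul_assoc]
      _ = _ := by rw [this, ← map_mul]
  | mul q₁ q₂ h₁ h₂ =>
    obtain ⟨k₂, e₂⟩ := h₂ p fun x hx => h x (mem_mul.2 (.inr hx))
    obtain ⟨k₁, e₁⟩ := h₁ (q₂ * p) fun x hx =>
      mem_mul.2 (.inr (h x (mem_mul.2 (.inl hx))))
    refine ⟨k₂ * k₁, ?_⟩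
    rw [← e₂, mul_assoc k₂ q₂, map_mul f k₂, ← e₁]
    simp only [map_mul, mul_assoc]

variable [PartialOrder M] [MulLeftMono M]

/-- Comparable elements of the same `ℋ`-class coincide. -/
theorem eq_of_le_of_green (hM : ∀ x : M, x ^ (n + 2) = x) {a b : M} (h : a ≤ b)
    (h₁ : ∃ k, a = b * k) (h₂ : ∃ k, b = a * k) (h₃ : ∃ k, a = k * b) (h₄ : ∃ k, b = k * a) :
    a = b := by
  have hl (x : M) : x ^ (n + 1) * x = x := by rw [← pow_succ, hM]
  have hr (x : M) : x * x ^ (n + 1) = x := by rw [← pow_succ', hM]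
  have hab : a ^ (n + 1) * b = b := by
    obtain ⟨k, hk⟩ := h₂
    rw [hk, ← mul_assoc, hl]
  have hba : b ^ (n + 1) * a = a := by
    obtain ⟨k, hk⟩ := h₁
    rw [hk, ← mul_assoc, hl]
  have hab' : a * b ^ (n + 1) = a := by
    obtain ⟨k, hk⟩ := h₃
    rw [hk, mul_assoc, hr]
  have hba' : b * a ^ (n + 1) = b := by
    obtain ⟨k, hk⟩ := h₄
    rw [hk, mul_assoc, hr]
  have hee : a ^ (n + 1) = b ^ (n + 1) :=
    calc a ^ (n + 1) = a ^ n * (a * b ^ (n + 1)) := by rw [hab', pow_succ]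
      _ = (a ^ (n + 1) * b) * b ^ n := by rw [pow_succ' b, pow_succ a]; simp only [mul_assoc]
      _ = b ^ (n + 1) := by rw [hab, pow_succ']
  -- In the group with identity $e=a^{n+1}$, the element $g=a^nb$ is $a^{-1}b$. From $e\le g$
  -- follows $g\le g^2\le\dots\le g^{n+2}=g$, so $g$ is idempotent and equals $e$.
  have hg₁ : a ^ (n + 1) ≤ a ^ n * b := by
    rw [pow_succ]
    exact mul_le_mul_right h _
  have hge : a ^ n * b * a ^ (n + 1) = a ^ n * b := by rw [mul_assoc, hba']
  have hgg : a ^ n * b * (b ^ n * a) = a ^ (n + 1) := by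
    calc a ^ n * b * (b ^ n * a) = a ^ n * (b ^ (n + 1) * a) := by
          rw [pow_succ' b]; simp only [mul_assoc]
      _ = _ := by rw [hba, pow_succ]
  have hstep : a ^ n * b ≤ (a ^ n * b) ^ 2 := by
    calc a ^ n * b = a ^ n * b * a ^ (n + 1) := hge.symm
      _ ≤ a ^ n * b * (a ^ n * b) := mul_le_mul_right hg₁ _
      _ = _ := (sq _).symm
  have hmono (m : ℕ) : (a ^ n * b) ^ 2 ≤ (a ^ n * b) ^ (m + 2) := by
    induction m with
    | zero => exact le_rfl
    | succ m ih =>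
      refine ih.trans ?_
      calc (a ^ n * b) ^ (m + 2) = (a ^ n * b) ^ (m + 1) * (a ^ n * b) := pow_succ _ _
        _ ≤ (a ^ n * b) ^ (m + 1) * (a ^ n * b) ^ 2 := mul_le_mul_right hstep _
        _ = _ := by rw [← pow_add]
  have hidem : (a ^ n * b) * (a ^ n * b) = a ^ n * b := by
    rw [← sq]
    exact le_antisymm ((hmono n).trans (hM _).le) hstep
  have hone : a ^ n * b = a ^ (n + 1) := by
    rw [← hge, ← hgg, ← mul_assoc (a ^ n * b), hidem]
  rw [← hab, pow_succ', mul_assoc, hone, hr]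

end PowEqSelf

/-! ### Stable preorders on words and the symmetry of inequalities -/

open FreeMonoid

/-- A stable preorder on a monoid is induced by a homomorphism to a partially ordered monoid. -/
theorem exists_hom_le_iff {N : Type*} [Monoid N] {r : N → N → Prop} (refl : ∀ u, r u u)
    (trans : ∀ {u v w}, r u v → r v w → r u w) (mul_left : ∀ w {u v}, r u v → r (w * u) (w * v))
    (mul_right : ∀ w {u v}, r u v → r (u * w) (v * w)) :
    ∃ (c : Con N) (_ : PartialOrder c.Quotient) (_ : MulLeftMono c.Quotient)
      (_ : MulRightMono c.Quotient), ∀ u v, r u v ↔ c.mk' u ≤ c.mk' v := by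
  let c : Con N :=
    { r := fun u v => r u v ∧ r v u
      iseqv := ⟨fun u => ⟨refl u, refl u⟩, And.symm,
        fun h h' => ⟨trans h.1 h'.1, trans h'.2 h.2⟩⟩
      mul' := fun {_ x y _} h h' => ⟨trans (mul_right _ h.1) (mul_left x h'.1),
        trans (mul_right _ h.2) (mul_left _ h'.2)⟩ }
  let le : c.Quotient → c.Quotient → Prop := fun p q => Con.liftOn₂ p q r
    fun _ _ _ _ h h' => propext
      ⟨fun H => trans h.2 (trans H h'.1), fun H => trans h.1 (trans H h'.2)⟩
  let inst : PartialOrder c.Quotient :=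
    { le := le
      le_refl := fun p => Con.induction_on p refl
      le_trans := fun p q s => Con.induction_on₂ p q fun _ _ => Con.induction_on s fun _ => trans
      le_antisymm := fun p q => Con.induction_on₂ p q fun _ _ h h' => (Con.eq c).2 ⟨h, h'⟩ }
  refine ⟨c, inst, ⟨fun p q s => ?_⟩, ⟨fun p q s => ?_⟩, fun u v => Iff.rfl⟩
  · exact Con.induction_on p fun w => Con.induction_on₂ q s fun _ _ h => mul_left w h
  · exact Con.induction_on p fun w => Con.induction_on₂ q s fun _ _ h => mul_right w h

variable {X : Type*} {n : ℕ} {r : FreeMonoid X → FreeMonoid X → Prop}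

/-- A stable preorder on the free monoid, invariant under nonerasing substitutions, whose quotient
satisfies `x ^ (n + 2) = x`: the inequalities of a variety of ordered completely regular
semigroups of exponent dividing `n + 1`. -/
structure IsCRPreorder (n : ℕ) (r : FreeMonoid X → FreeMonoid X → Prop) : Prop where
  refl : ∀ u, r u u
  trans : ∀ {u v w}, r u v → r v w → r u w
  mul_left : ∀ w {u v}, r u v → r (w * u) (w * v)
  mul_right : ∀ w {u v}, r u v → r (u * w) (v * w)
  map : ∀ σ : X → FreeMonoid X, (∀ x, σ x ≠ 1) → ∀ {u v}, r u v → r (lift σ u) (lift σ v)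
  pow_le : ∀ u, r (u ^ (n + 2)) u
  le_pow : ∀ u, r u (u ^ (n + 2))

namespace IsCRPreorder

theorem reverse (hr : IsCRPreorder n r) :
    IsCRPreorder n fun u v => r (FreeMonoid.reverse u) (FreeMonoid.reverse v) where
  refl _ := hr.refl _
  trans := hr.trans
  mul_left w u v h := by simpa only [reverse_mul] using hr.mul_right _ h
  mul_right w u v h := by simpa only [reverse_mul] using hr.mul_left _ h
  map σ hσ u v h := by
    simp only [reverse_lift]
    refine hr.map _ (fun x hx => hσ x ?_) h
    rw [← reverse_reverse (a := σ x), hx]; rfl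
  pow_le u := by simpa only [reverse_pow] using hr.pow_le _
  le_pow u := by simpa only [reverse_pow] using hr.le_pow _

/-- `u ⊑ v` if in every context to the right, `u` lies below `v` up to a factor at the end. -/
theorem rightFactor (hr : IsCRPreorder n r) : IsCRPreorder n fun u v =>
    ∀ σ : X → FreeMonoid X, (∀ x, σ x ≠ 1) → ∀ s, s ≠ 1 →
      ∃ w, r (lift σ u * s) (lift σ v * s * w) := by
  -- Quantifying over `σ` gives invariance under substitution; quantifying over `s` gives stability
  -- on the right, the new right factor being moved into `s`.
  have of_rel {u v} (h : r u v) (σ : X → FreeMonoid X) (hσ : ∀ x, σ x ≠ 1) (s : FreeMonoid X)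
      (_ : s ≠ 1) : ∃ w, r (lift σ u * s) (lift σ v * s * w) :=
    ⟨1, by rw [mul_one]; exact hr.mul_right _ (hr.map σ hσ h)⟩
  refine ⟨fun u => of_rel (hr.refl u), ?_, ?_, ?_, ?_, fun u => of_rel (hr.pow_le u),
    fun u => of_rel (hr.le_pow u)⟩
  · intro u v w h₁ h₂ σ hσ s hs
    obtain ⟨w₁, h₁⟩ := h₁ σ hσ s hs
    obtain ⟨w₂, h₂⟩ := h₂ σ hσ s hs
    exact ⟨w₂ * w₁, hr.trans h₁ (by simpa only [mul_assoc] using hr.mul_right w₁ h₂)⟩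
  · intro w u v h σ hσ s hs
    obtain ⟨w₁, h⟩ := h σ hσ s hs
    exact ⟨w₁, by simpa only [map_mul, mul_assoc] using hr.mul_left (lift σ w) h⟩
  · intro w u v h σ hσ s hs
    obtain ⟨w₁, h⟩ := h σ hσ (lift σ w * s) (mul_ne_one_left hs _)
    exact ⟨w₁, by simpa only [map_mul, mul_assoc] using h⟩
  · intro τ hτ u v h σ hσ s hs
    have key (p : FreeMonoid X) : lift σ (lift τ p) = lift (fun x => lift σ (τ x)) p :=
      hom_map_lift (lift σ) τ p
    simp only [key]
    exact h _ (fun x => lift_ne_one hσ (hτ x)) s hs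

theorem exists_hom (hr : IsCRPreorder n r) :
    ∃ (c : Con (FreeMonoid X)) (_ : PartialOrder c.Quotient) (_ : MulLeftMono c.Quotient)
      (_ : MulRightMono c.Quotient), (∀ u v, r u v ↔ c.mk' u ≤ c.mk' v) ∧
      ∀ x : c.Quotient, x ^ (n + 2) = x := by
  obtain ⟨c, i₁, i₂, i₃, h⟩ := exists_hom_le_iff hr.refl hr.trans hr.mul_left hr.mul_right
  refine ⟨c, i₁, i₂, i₃, h, fun x => Con.induction_on x fun u => ?_⟩
  exact le_antisymm ((h _ _).1 (hr.pow_le u)) ((h _ _).1 (hr.le_pow u))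

/-- A word absorbs on its right every word over its letters, up to a factor at the end. -/
theorem exists_absorb (hr : IsCRPreorder n r) {p q : FreeMonoid X} (h : ∀ x ∈ q, x ∈ p) :
    ∃ k, (∀ x ∈ k, x ∈ p) ∧ r p (p * q * k) ∧ r (p * q * k) p := by
  obtain ⟨c, _, _, _, hc, hM⟩ := hr.exists_hom
  obtain ⟨k, hk, e⟩ := exists_map_mul_mul_eq_map hM c.mk' q p h
  exact ⟨k, hk, (hc _ _).2 e.ge, (hc _ _).2 e.le⟩

theorem lift_const_mul (hr : IsCRPreorder n r) {e v : FreeMonoid X} (h₁ : r v (e * v))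
    (h₂ : r (e * v) v) (p : FreeMonoid X) :
    r v (lift (fun _ => e) p * v) ∧ r (lift (fun _ => e) p * v) v := by
  induction p with
  | one => simpa using hr.refl v
  | of x => exact ⟨h₁, h₂⟩
  | mul p q hp hq =>
    rw [map_mul, mul_assoc]
    exact ⟨hr.trans hp.1 (hr.mul_left _ hq.1), hr.trans (hr.mul_left _ hq.2) hp.2⟩

theorem pow_mul_self (hr : IsCRPreorder n r) (p q : FreeMonoid X) :
    r (p * q) (p ^ (n + 1) * (p * q)) ∧ r (p ^ (n + 1) * (p * q)) (p * q) := by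
  rw [← mul_assoc, ← pow_succ]
  exact ⟨hr.mul_right q (hr.le_pow p), hr.mul_right q (hr.pow_le p)⟩

/-- Two letters that occur in a different order on the two sides can be exchanged. -/
theorem exists_le_mul_of_swap (hr : IsCRPreorder n r) {u v u₀ u₁ v₀ v₁ e : FreeMonoid X} {a b : X}
    (h : r u v) (huv : ∀ x, x ∈ u ↔ x ∈ v) (hu : u = u₀ * of b * u₁) (hv : v = v₀ * of a * v₁)
    (hab : a ≠ b) (hau : a ∉ u₀) (hbu : b ∉ u₀) (hav : a ∉ v₀) (hbv : b ∉ v₀) (he : e ≠ 1)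
    (hev : ∀ x ∈ e, x ∈ v) (h₁ : r v (lift (fun _ => e) u₀ * v))
    (h₂ : r (lift (fun _ => e) v₀ * u) u) : ∃ w, (∀ x ∈ w, x ∈ u) ∧ r v (u * w) := by
  classical
  have hu1 : u ≠ 1 := by
    rintro rfl
    have : b ∈ (1 : FreeMonoid X) := by rw [hu]; simp
    exact notMem_one this
  have hv1 : v ≠ 1 := by
    rintro rfl
    have : a ∈ (1 : FreeMonoid X) := by rw [hv]; simp
    exact notMem_one this
  -- This turns $u$ into $e\cdots e\,v\cdots$ and $v$ into $e\cdots e\,u\cdots$. The hypotheses `h₁`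
  -- and `h₂` dispose of the leading copies of $e$.
  let σ : X → FreeMonoid X := fun x => if x = b then v else if x = a then u else e
  have hσ1 : ∀ x, σ x ≠ 1 := by
    intro x; simp only [σ]; split_ifs <;> assumption
  have hσv : ∀ p, ∀ x ∈ lift σ p, x ∈ v := by
    intro p x hx
    obtain ⟨y, -, hy⟩ := exists_mem_of_mem_lift hx
    simp only [σ] at hy
    split_ifs at hy
    · exact hy
    · exact (huv x).1 hy
    · exact hev x hy
  have hσb : σ b = v := if_pos rfl
  have hσa : σ a = u := by simp [σ, hab]
  have hσe {p : FreeMonoid X} (ha : a ∉ p) (hb : b ∉ p) : lift σ p = lift (fun _ => e) p :=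
    lift_congr fun x hx => by
      rw [show σ x = _ from if_neg (ne_of_mem_of_not_mem hx hb),
        if_neg (ne_of_mem_of_not_mem hx ha)]
  have key := hr.map σ hσ1 h
  have e₁ : lift σ u = lift (fun _ => e) u₀ * v * lift σ u₁ := by
    conv_lhs => rw [hu]
    rw [map_mul, map_mul, hσe hau hbu, lift_eval_of, hσb]
  have e₂ : lift σ v = lift (fun _ => e) v₀ * u * lift σ v₁ := by
    conv_lhs => rw [hv]
    rw [map_mul, map_mul, hσe hav hbv, lift_eval_of, hσa]
  rw [e₁, e₂] at key
  obtain ⟨k, hk, hk₁, -⟩ := hr.exists_absorb (hσv u₁)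
  refine ⟨lift σ v₁ * k, fun x hx => (huv x).2 ?_, ?_⟩
  · exact (mem_mul.1 hx).elim (hσv _ x) (hk x)
  · refine hr.trans hk₁ (hr.trans (hr.mul_right k (hr.mul_right _ h₁)) ?_)
    refine hr.trans (hr.mul_right k key) ?_
    simpa only [mul_assoc] using hr.mul_right k (hr.mul_right (lift σ v₁) h₂)

/-- The converse inequality holds up to a factor at the end, if inequalities between words with
fewer letters are symmetric. -/
theorem exists_le_mul (hr : IsCRPreorder n r) {u v : FreeMonoid X} (h : r u v)
    (huv : ∀ x, x ∈ u ↔ x ∈ v)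
    (ih : ∀ {r' : FreeMonoid X → FreeMonoid X → Prop}, IsCRPreorder n r' →
      ∀ {u' v' : FreeMonoid X}, (∀ x, x ∈ u' ↔ x ∈ v') → (∀ x ∈ u', x ∈ u) → (∃ x ∈ u, x ∉ u') →
        r' u' v' → r' v' u') :
    ∃ w, (∀ x ∈ w, x ∈ u) ∧ r v (u * w) := by
  classical
  by_cases hu1 : u = 1
  · subst hu1
    refine ⟨1, fun x hx => hx, ?_⟩
    have : v = 1 := by
      by_contra hv
      obtain ⟨x, q, rfl⟩ := exists_eq_of_mul hv
      exact notMem_one ((huv x).2 (by simp))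
    rw [this, mul_one]
    exact hr.refl 1
  have hv1 : v ≠ 1 := by
    rintro rfl
    obtain ⟨x, q, rfl⟩ := exists_eq_of_mul hu1
    exact notMem_one ((huv x).1 (by simp))
  obtain ⟨u₀, a, u₁, hu, hau, hu₁⟩ := exists_last_new_letter hu1
  obtain ⟨v₀, b, v₁, hv, hbv, hv₁⟩ := exists_last_new_letter hv1
  have hmu (x : X) : x ∈ u ↔ x ∈ u₀ ∨ x = a := by
    have := hu₁ x
    simp only [hu, mem_mul, mem_of] at this ⊢
    tauto
  have hmv (x : X) : x ∈ v ↔ x ∈ v₀ ∨ x = b := by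
    have := hv₁ x
    simp only [hv, mem_mul, mem_of] at this ⊢
    tauto
  by_cases hab : a = b
  · subst hab
    have hm₀ (x : X) : x ∈ u₀ ↔ x ∈ v₀ := by
      have := huv x
      rw [hmu, hmv] at this
      by_cases hx : x = a
      · subst hx; tauto
      · tauto
    have hle := ih hr.rightFactor hm₀ (fun x hx => (hmu x).2 (.inl hx))
      -- As `a` occurs in neither prefix, it may be sent to `s` while the other letters follow `σ`.
      -- The tail of $u$ is first absorbed by $u_0a$.
      ⟨a, (hmu a).2 (.inr rfl), hau⟩ fun σ hσ s hs => by
        let τ : X → FreeMonoid X := fun x => if x = a then s else σ x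
        have hτ : ∀ x, τ x ≠ 1 := by intro x; simp only [τ]; split_ifs <;> simp [hσ, hs]
        have hτa : τ a = s := if_pos rfl
        have hτσ {p : FreeMonoid X} (hp : a ∉ p) : lift τ p = lift σ p :=
          lift_congr fun x hx => if_neg (ne_of_mem_of_not_mem hx hp)
        have key := hr.map τ hτ h
        obtain ⟨k, -, hk, -⟩ := hr.exists_absorb hu₁
        have hk' := hr.map τ hτ hk
        have key' := hr.mul_right (lift τ k) key
        rw [hv] at key'
        rw [← hu] at hk'
        simp only [map_mul, lift_eval_of, hτa, hτσ hau, hτσ hbv] at hk' key'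
        exact ⟨lift τ v₁ * lift τ k, by simpa only [mul_assoc] using hr.trans hk' key'⟩
    obtain ⟨w, hw⟩ := hle of (fun x => of_ne_one x) (of a) (of_ne_one a)
    have hid (p : FreeMonoid X) : lift (of : X → FreeMonoid X) p = p :=
      DFunLike.congr_fun (lift_restrict (MonoidHom.id (FreeMonoid X))) p
    simp only [hid] at hw
    -- The factor `w` may contain foreign letters; they are replaced by `a`, which leaves both
    -- prefixes unchanged.
    let τ : X → FreeMonoid X := fun x => if x ∈ u then of x else of a
    have hau' : a ∈ u := (hmu a).2 (.inr rfl)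
    have hτid {p : FreeMonoid X} (hp : ∀ x ∈ p, x ∈ u) : lift τ p = p :=
      (lift_congr fun x hx => if_pos (hp x hx)).trans (hid p)
    have hτu (p : FreeMonoid X) : ∀ x ∈ lift τ p, x ∈ u := by
      intro x hx
      obtain ⟨y, -, hy⟩ := exists_mem_of_mem_lift hx
      simp only [τ] at hy
      split_ifs at hy with hyu <;> rw [mem_of.1 hy] <;> assumption
    have hw' := hr.map τ (fun x => by simp only [τ]; split_ifs <;> exact of_ne_one _) hw
    rw [map_mul _ _ w, hτid (p := v₀ * of a), hτid (p := u₀ * of a)] at hw'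
    · obtain ⟨k, hk, hk₁, -⟩ := hr.exists_absorb hu₁
      rw [← hu] at hk₁
      refine ⟨k * lift τ w * v₁, ?_, ?_⟩
      · intro x hx
        rcases mem_mul.1 hx with hx | hx
        · rcases mem_mul.1 hx with hx | hx
          · have := hk x hx
            rw [hmu]
            simpa using this
          · exact hτu w x hx
        · rw [huv, hmv]
          simpa using hv₁ x hx
      · have h₁ := hr.mul_right v₁ hw'
        rw [← hv] at h₁
        exact hr.trans h₁ (by simpa only [mul_assoc] using hr.mul_right (lift τ w * v₁) hk₁)
    · intro x hx; rw [hmu]; simpa using hx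
    · intro x hx; rw [huv, hmv]; simpa using hx
  · obtain ⟨x, u', hu'⟩ := exists_eq_of_mul hu1
    obtain ⟨y, v', hv'⟩ := exists_eq_of_mul hv1
    by_cases hxy : x = y
    · subst hxy
      have hbu₀ : b ∈ u₀ := by
        have := (huv b).2 ((hmv b).2 (.inr rfl))
        rw [hmu] at this
        exact this.resolve_right (Ne.symm hab)
      have hav₀ : a ∈ v₀ := by
        have := (huv a).1 ((hmu a).2 (.inr rfl))
        rw [hmv] at this
        exact this.resolve_right hab
      obtain ⟨s, t, rfl, hbs⟩ := exists_eq_mul_of_mul hbu₀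
      obtain ⟨s', t', rfl, has⟩ := exists_eq_mul_of_mul hav₀
      simp only [mem_mul, not_or] at hau hbv
      -- Both words begin with `x`, so $x^{n+1}$ is a left identity for each of them.
      refine hr.exists_le_mul_of_swap (u₁ := t * of a * u₁) (v₁ := t' * of b * v₁)
        (e := of x ^ (n + 1)) h huv (by simpa only [mul_assoc] using hu)
        (by simpa only [mul_assoc] using hv) hab hau.1.1 hbs has hbv.1.1 ?_ ?_ ?_ ?_
      · rw [pow_succ]; exact mul_ne_one_left (of_ne_one x) _
      · intro z hz
        rw [mem_of.1 (mem_of_mem_pow hz), hv']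
        simp
      · have := hr.pow_mul_self (of x) v'
        rw [← hv'] at this
        exact (hr.lift_const_mul this.1 this.2 s).1
      · have := hr.pow_mul_self (of x) u'
        rw [← hu'] at this
        exact (hr.lift_const_mul this.1 this.2 s').2
    -- The distinct first letters are exchanged. The prefixes are empty, so `e` only has to be a
    -- nonempty word over the letters of $v$.
    · refine hr.exists_le_mul_of_swap (u₀ := 1) (v₀ := 1) (a := y) (b := x) (e := of y) h huv
        (by simpa using hu') (by simpa using hv') (Ne.symm hxy) notMem_one notMem_one notMem_one
        notMem_one (of_ne_one y) ?_ ?_ ?_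
      · intro z hz
        rw [mem_of.1 hz, hv']
        simp
      · simpa using hr.refl v
      · simpa using hr.refl u

/-- Words that lie below each other up to factors at the end agree up to factors at the end. -/
theorem exists_rel_mul (hr : IsCRPreorder n r) {u v w₁ w₂ : FreeMonoid X} (h₁ : r u (v * w₁))
    (h₂ : r v (u * w₂)) (hw₁ : ∀ x ∈ w₁, x ∈ u) (hw₂ : ∀ x ∈ w₂, x ∈ u) :
    ∃ k, r u (v * k) ∧ r (v * k) u := by
  obtain ⟨c, _, _, _, hc, hM⟩ := hr.exists_hom
  have hur : c.mk' u * c.mk' u ^ (n + 1) = c.mk' u := by rw [← pow_succ', hM]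
  have hle₁ : c.mk' u ≤ c.mk' (v * (w₁ * u ^ (n + 1))) := by
    calc c.mk' u = c.mk' u * c.mk' u ^ (n + 1) := hur.symm
      _ ≤ c.mk' (v * w₁) * c.mk' u ^ (n + 1) := mul_le_mul_left ((hc _ _).1 h₁) _
      _ = _ := by simp only [map_mul, map_pow, mul_assoc]
  have hle₂ : c.mk' (v * (w₁ * u ^ (n + 1))) ≤ c.mk' (u * (w₂ * w₁ * u ^ (n + 1))) := by
    calc c.mk' (v * (w₁ * u ^ (n + 1))) = c.mk' v * c.mk' (w₁ * u ^ (n + 1)) := map_mul _ _ _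
      _ ≤ c.mk' (u * w₂) * c.mk' (w₁ * u ^ (n + 1)) := mul_le_mul_left ((hc _ _).1 h₂) _
      _ = _ := by simp only [map_mul, mul_assoc]
  have hw (m : ℕ) : ∀ x ∈ w₂ * w₁ * u ^ m, x ∈ u := by
    intro x hx
    simp only [mem_mul] at hx
    rcases hx with (hx | hx) | hx
    exacts [hw₂ x hx, hw₁ x hx, mem_of_mem_pow hx]
  obtain ⟨k, -, hk⟩ := exists_map_mul_mul_eq_map hM c.mk' _ u (hw (n + 1))
  obtain ⟨l, hl⟩ := exists_map_mul_mul_eq_map' hM c.mk' u (u * (w₂ * w₁ * u ^ n))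
    fun x hx => (mem_mul.1 hx).elim id (hw n x)
  -- The right-hand side begins and ends with $u$ and has no new letters, so it is $\mathcal
  -- H$-related to $u$. Equality of the outer terms collapses the chain `hle₁`, `hle₂`.
  have heq : c.mk' u = c.mk' (u * (w₂ * w₁ * u ^ (n + 1))) := by
    refine eq_of_le_of_green hM (hle₁.trans hle₂) ⟨c.mk' k, ?_⟩ ⟨_, map_mul _ _ _⟩
      ⟨c.mk' l, ?_⟩ ⟨c.mk' (u * (w₂ * w₁ * u ^ n)), ?_⟩
    · rw [← map_mul, hk]
    · rw [← map_mul, ← hl]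
      simp only [pow_succ, mul_assoc]
    · rw [← map_mul]
      simp only [pow_succ, mul_assoc]
  exact ⟨_, (hc _ _).2 hle₁, (hc _ _).2 (hle₂.trans heq.ge)⟩

/-- Inequalities between words over the same letters are symmetric. -/
theorem symm_of_mem_iff (hr : IsCRPreorder n r) {u v : FreeMonoid X} (h : r u v)
    (huv : ∀ x, x ∈ u ↔ x ∈ v) : r v u := by
  classical
  -- The preorder varies too: the induction hypothesis is needed for the auxiliary preorder
  -- `rightFactor`, also that of the reversed preorder.
  induction hm : u.symbols.card using Nat.strong_induction_on generalizing r u v with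
  | _ m ih =>
    have rightCase {r : FreeMonoid X → FreeMonoid X → Prop} (hr : IsCRPreorder n r)
        {u v : FreeMonoid X} (h : r u v) (huv : ∀ x, x ∈ u ↔ x ∈ v) (hm : u.symbols.card = m) :
        (∃ k, r u (v * k) ∧ r (v * k) u) ∧ ∃ k, r v (u * k) ∧ r (u * k) v := by
      obtain ⟨w, hw, hle⟩ := hr.exists_le_mul h huv fun hr' u' v' huv' hsub hlt h' => by
        refine ih _ ?_ hr' h' huv' rfl
        rw [← hm]
        refine Finset.card_lt_card ((Finset.ssubset_iff_of_subset fun x hx => ?_).2 ?_)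
        · exact mem_symbols.2 (hsub x (mem_symbols.1 hx))
        · obtain ⟨x, hx, hx'⟩ := hlt
          exact ⟨x, mem_symbols.2 hx, fun h => hx' (mem_symbols.1 h)⟩
      have h1 : r u (v * 1) := by rwa [mul_one]
      exact ⟨hr.exists_rel_mul h1 hle (fun x hx => absurd hx notMem_one) hw,
        hr.exists_rel_mul hle h1 (fun x hx => (huv x).1 (hw x hx))
          fun x hx => absurd hx notMem_one⟩
    obtain ⟨⟨k₁, hk₁, hk₁'⟩, k₂, hk₂, hk₂'⟩ := rightCase hr h huv hm
    have hsym : (FreeMonoid.reverse u).symbols.card = m := by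
      rw [← hm]
      congr 1
      ext x
      simp only [mem_symbols, mem_reverse]
    obtain ⟨⟨k₃, hk₃, hk₃'⟩, k₄, hk₄, hk₄'⟩ := rightCase hr.reverse
      (u := FreeMonoid.reverse u) (v := FreeMonoid.reverse v) (by simpa only [reverse_reverse])
      (fun x => by rw [mem_reverse, mem_reverse, huv]) hsym
    simp only [reverse_mul, reverse_reverse] at hk₃ hk₃' hk₄ hk₄'
    obtain ⟨c, _, _, _, hc, hM⟩ := hr.exists_hom
    refine (hc _ _).2 (eq_of_le_of_green hM ((hc _ _).1 h) ⟨c.mk' k₁, ?_⟩ ⟨c.mk' k₂, ?_⟩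
      ⟨c.mk' (FreeMonoid.reverse k₃), ?_⟩ ⟨c.mk' (FreeMonoid.reverse k₄), ?_⟩).ge <;> rw [← map_mul]
    exacts [le_antisymm ((hc _ _).1 hk₁) ((hc _ _).1 hk₁'),
      le_antisymm ((hc _ _).1 hk₂) ((hc _ _).1 hk₂'),
      le_antisymm ((hc _ _).1 hk₃) ((hc _ _).1 hk₃'),
      le_antisymm ((hc _ _).1 hk₄) ((hc _ _).1 hk₄')]

end IsCRPreorder

/-! ### Inequalities valid in a finite completely regular ordered semigroup -/

/-- The inequalities between words that hold in an ordered semigroup; the empty word is comparable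
only to itself. -/
def HoldsLE (X T : Type*) [Semigroup T] [LE T] (u v : FreeMonoid X) : Prop :=
  ∀ φ : X → T, Option.Rel (· ≤ ·) (lift (fun x => (φ x : WithOne T)) u)
    (lift (fun x => (φ x : WithOne T)) v)

/-- By finiteness two power maps $x\mapsto x^i$ and $x\mapsto x^j$ agree; inverses in the subgroup
containing $x$ cancel the common exponent down to $1$. -/
theorem IsCompletelyRegular.exists_pow_add_two_eq {T : Type*} [Semigroup T] [Finite T]
    (hT : IsCompletelyRegular T) : ∃ n, ∀ x : WithOne T, x ^ (n + 2) = x := by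
  have : Finite (WithOne T) := inferInstanceAs (Finite (Option T))
  obtain ⟨i, j, hij, h⟩ : ∃ i j : ℕ, i < j ∧ ∀ x : WithOne T, x ^ i = x ^ j := by
    obtain ⟨i, j, hne, h⟩ :=
      Finite.exists_ne_map_eq_of_infinite fun (k : ℕ) (x : WithOne T) => x ^ k
    rcases hne.lt_or_gt with hlt | hlt
    · exact ⟨i, j, hlt, congrFun h⟩
    · exact ⟨j, i, hlt, fun x => (congrFun h x).symm⟩
  obtain ⟨n, rfl⟩ : ∃ n, j = i + (n + 1) := ⟨j - i - 1, by omega⟩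
  refine ⟨n, WithOne.forall.2 ⟨one_pow _, fun s => ?_⟩⟩
  obtain ⟨G, ⟨e, -, heG, hinv⟩, hs⟩ := hT s
  obtain ⟨b, -, hb, -⟩ := hinv s hs
  have hes : (e : WithOne T) * s = s := by rw [← WithOne.coe_mul, (heG s hs).1]
  have hbs : (b : WithOne T) * s = e := by rw [← WithOne.coe_mul, hb]
  have hdesc (k : ℕ) : (b : WithOne T) * (s : WithOne T) ^ (k + 2) = (s : WithOne T) ^ (k + 1) := by
    rw [pow_succ', ← mul_assoc, hbs, pow_succ', ← mul_assoc, hes]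
  have key (k : ℕ) (hk : (s : WithOne T) ^ (k + 1) = (s : WithOne T) ^ (k + 1 + (n + 1))) :
      (s : WithOne T) ^ (n + 2) = s := by
    induction k with
    | zero => rw [show n + 2 = 0 + 1 + (n + 1) by omega, ← hk, zero_add, pow_one]
    | succ k ih =>
      refine ih ?_
      rw [← hdesc k, hk, show k + 1 + 1 + (n + 1) = k + n + 1 + 2 by omega, hdesc]
      congr 1
      omega
  refine key i ?_
  rw [pow_succ, h s, ← pow_succ]
  congr 1
  omega

theorem HoldsLE.isCRPreorder (X : Type*) {T : Type*} [Semigroup T] [PartialOrder T] [MulLeftMono T]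
    [MulRightMono T] {n : ℕ} (hn : ∀ x : WithOne T, x ^ (n + 2) = x) :
    IsCRPreorder n (HoldsLE X T) := by
  have refl (a : WithOne T) : Option.Rel (· ≤ ·) a a := by
    cases a with
    | one => exact .none
    | coe a => exact .some le_rfl
  have trans {a b c : WithOne T} (h₁ : Option.Rel (· ≤ ·) a b) (h₂ : Option.Rel (· ≤ ·) b c) :
      Option.Rel (· ≤ ·) a c := by
    cases h₁ with
    | some h =>
      cases h₂ with
      | some h' => exact .some (h.trans h')
    | none => exact h₂
  have mul_left (c : WithOne T) {a b : WithOne T} (h : Option.Rel (· ≤ ·) a b) :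
      Option.Rel (· ≤ ·) (c * a) (c * b) := by
    cases h with
    | some h =>
      cases c with
      | one => exact .some h
      | coe c => exact .some (mul_le_mul_right h c)
    | none => exact refl _
  have mul_right (c : WithOne T) {a b : WithOne T} (h : Option.Rel (· ≤ ·) a b) :
      Option.Rel (· ≤ ·) (a * c) (b * c) := by
    cases h with
    | some h =>
      cases c with
      | one => exact .some h
      | coe c => exact .some (mul_le_mul_left h c)
    | none => exact refl _
  refine ⟨fun u φ => refl _, fun h₁ h₂ φ => ?_, fun w u v h φ => ?_, fun w u v h φ => ?_,
    fun σ hσ u v h φ => ?_, fun u φ => ?_, fun u φ => ?_⟩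
  · exact trans (h₁ φ) (h₂ φ)
  · rw [map_mul, map_mul]; exact mul_left _ (h φ)
  · rw [map_mul, map_mul]; exact mul_right _ (h φ)
  -- Nonerasing substitutions matter here: the value of `σ x` must lie in `T`, not be the adjoined
  -- identity, to be a new assignment.
  · have hcoe : ∀ p : FreeMonoid X, p ≠ 1 →
        ∃ t : T, lift (fun x => (φ x : WithOne T)) p = t := by
      intro p hp
      obtain ⟨x, q, rfl⟩ := exists_eq_of_mul hp
      rw [map_mul, lift_eval_of]
      generalize lift (fun x => (φ x : WithOne T)) q = c
      cases c with
      | one => exact ⟨φ x, mul_one _⟩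
      | coe c => exact ⟨φ x * c, rfl⟩
    choose ψ hψ using fun x => hcoe (σ x) (hσ x)
    have := h ψ
    simp only [← hψ] at this
    simpa only [hom_map_lift, Function.comp_def] using this
  · rw [map_pow, hn]; exact refl _
  · rw [map_pow, hn]; exact refl _

/-! ### The generated subsemigroup `F` and duality -/

namespace FinOrdSemigroup

/-- The semilattice of subsets of a finite set under union, ordered by equality. -/
def subsets (X : Type u) [Finite X] : FinOrdSemigroup.{u} :=
  let S : Semigroup (Set X) := { mul := (· ∪ ·), mul_assoc := Set.union_assoc }
  { carrier := Set X
    semigroup := S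
    partialOrder :=
      { le := Eq
        lt := fun _ _ => False
        le_refl := fun _ => rfl
        le_trans := fun _ _ _ => Eq.trans
        lt_iff_le_not_ge := fun _ _ => ⟨False.elim, fun h => h.2 h.1.symm⟩
        le_antisymm := fun _ _ h _ => h }
    mulLeftMono := ⟨fun a _ _ h => congrArg (S.mul a) h⟩
    mulRightMono := ⟨fun a _ _ h => congrArg (S.mul · a) h⟩ }

theorem isSemilattice_subsets (X : Type u) [Finite X] : IsSemilattice (subsets X) :=
  ⟨fun s => Set.union_self (α := X) s, fun s t => Set.union_comm (α := X) s t⟩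

end FinOrdSemigroup

open FinOrdSemigroup

theorem IsPseudovariety.dual_mem {V : Set FinOrdSemigroup.{u}} (hV : IsPseudovariety V)
    (hSl : ∀ S : FinOrdSemigroup.{u}, IsSemilattice S → S ∈ V) {S : FinOrdSemigroup.{u}}
    (hS : S ∈ V) (hCR : IsCompletelyRegular S) : S.dual ∈ V := by
  -- The factors of the power of `S` correspond to the assignments of the letters, numbered by `e`.
  obtain ⟨N, ⟨e⟩⟩ := Finite.exists_equiv_fin (S → S)
  let P : FinOrdSemigroup.{u} := pi fun _ : Fin N => S
  let G : FinOrdSemigroup.{u} := pi ![P, subsets S]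
  have hG : G ∈ V := by
    refine hV.pi_mem 2 _ fun i => ?_
    fin_cases i
    · exact hV.pi_mem N _ fun _ => hS
    · exact hSl _ (isSemilattice_subsets S)
  let value (p : G) (φ : S → S) : S := (p 0 : P) (e φ)
  let content (p : G) : Set S := p 1
  let gen (s : S) : G := Fin.cons (fun i => e.symm i s) (Fin.cons ({s} : Set S) finZeroElim)
  let F := Subsemigroup.closure (Set.range gen)
  have hword : ∀ p ∈ F, ∃ u : FreeMonoid S,
      (∀ φ : S → S, lift (fun x => (φ x : WithOne S)) u = (value p φ : WithOne S)) ∧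
      ∀ x, x ∈ u ↔ x ∈ content p := by
    intro p hp
    induction hp using Subsemigroup.closure_induction with
    | mem p hp =>
      obtain ⟨s, rfl⟩ := hp
      refine ⟨of s, fun φ => ?_, fun x => mem_of⟩
      have : value (gen s) φ = φ s := congrFun (e.symm_apply_apply φ) s
      rw [this, lift_eval_of]
    | mul p q _ _ hp hq =>
      obtain ⟨u, hu, hu'⟩ := hp
      obtain ⟨v, hv, hv'⟩ := hq
      refine ⟨u * v, fun φ => ?_, fun x => ?_⟩
      · rw [map_mul, hu, hv, ← WithOne.coe_mul]; rfl
      · rw [mem_mul, hu', hv']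
        exact (Set.mem_union x (content p) (content q)).symm
  obtain ⟨n, hn⟩ := hCR.exists_pow_add_two_eq
  have hanti : ∀ p ∈ F, ∀ q ∈ F, p ≤ q → value q id ≤ value p id := by
    intro p hp q hq hpq
    obtain ⟨u, hu, hu'⟩ := hword p hp
    obtain ⟨v, hv, hv'⟩ := hword q hq
    -- The order on subsets is equality.
    have hc : content p = content q := hpq 1
    have huv : HoldsLE S S u v := fun φ => by
      rw [hu, hv]
      exact .some (hpq 0 (e φ))
    have := (HoldsLE.isCRPreorder S hn).symm_of_mem_iff huv
      (fun x => by rw [hu', hv', hc]) id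
    rw [hu, hv] at this
    cases this with
    | some h => exact h
  have hF : (F : Set G).Nonempty :=
    ⟨gen (Classical.arbitrary S), Subsemigroup.subset_closure ⟨_, rfl⟩⟩
  refine hV.image_mem _ (hV.subsemigroup_mem G hG F hF) S.dual
    { toFun := fun p => OrderDual.toDual (value p.1 id), map_mul' := fun _ _ => rfl }
    (fun p q h => hanti p.1 p.2 q.1 q.2 h) fun s => ?_
  exact ⟨⟨gen (OrderDual.ofDual s), Subsemigroup.subset_closure ⟨_, rfl⟩⟩,
    congrFun (e.symm_apply_apply id) (OrderDual.ofDual s)⟩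

theorem theorem1 (V : Set FinOrdSemigroup.{u}) (hV : IsPseudovariety V)
    (hCR : ∀ S ∈ V, IsCompletelyRegular S)
    (hSl : ∀ S : FinOrdSemigroup.{u}, IsSemilattice S → S ∈ V) :
    IsSelfdual V := by
  refine Set.Subset.antisymm (fun S hS => hV.dual_mem hSl hS (hCR S hS)) fun S hS => ?_
  -- Dualizing `S.dual` once more returns `S`, up to the identity map.
  refine hV.image_mem _ (hV.dual_mem hSl hS (hCR _ hS)) S
    { toFun := fun s => OrderDual.ofDual (OrderDual.ofDual s), map_mul' := fun _ _ => rfl }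
    (fun _ _ h => h) fun s => ⟨OrderDual.toDual (OrderDual.toDual s), rfl⟩
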